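/- Let $q$ be a complex number with $0<|q|<1$. Write $(x;q)_\infty=\prod_{i\ge 0}(1-xq^i)$, $(x;q)_n=\prod_{i=0}^{n-1}(1-xq^i)$, let a list of parameters denote the product of the corresponding factors, and put $$\theta(q,x)=\sum_{n=0}^{\infty}(-1)^nq^{\binom n2}x^n,\qquad P_m(a,b)=(q,a,b;q)_\infty\sum_{n=0}^{\infty}\frac{(ab/q^m;q)_{2n}}{(q,a,b,ab/q^m;q)_n}\,q^n .$$ Then, for every integer $m\ge 2$, $P_m(a,b)$ is a linear combination of the $2(m-1)$ functions $\theta(q,a/q^k)$ and $\theta(q,b/q^k)$, $0\le k\le m-2$, with coefficients that are rational functions of $q,a,b$. More precisely, for every integer $m\ge2$ there are polynomials $D,A_0,\dots,A_{m-2},B_0,\dots,B_{m-2}\in\mathbb{Q}[q,a,b]$ such that, for all complex $q,a,b$ with $0<|q|<1$ and $a\ne bq^n$ for every integer $n$ with $|n|\le m-2$, one has $D(q,a,b)\neq 0$, and $$P_m(a,b)=\sum_{k=0}^{m-2}\frac{A_k(q,a,b)}{D(q,a,b)}\,\theta(q,a/q^k)+\sum_{k=0}^{m-2}\frac{B_k(q,a,b)}{D(q,a,b)}\,\theta(q,b/q^k)$$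 whenever the terms of the series $P_m(a,b)$ have nonzero denominators, that is, $aq^i\ne1$, $bq^i\neq 1$ and $abq^{i}\ne q^{m}$ for all integers $i\ge0$. -/

import Mathlib

noncomputable section

/-- The infinite `q`-shifted factorial `(x;q)_∞ = ∏_{i ≥ 0} (1 - x q^i)`, for `|q| < 1`. -/
def qPochInf (x q : ℂ) : ℂ := ∏' i : ℕ, (1 - x * q ^ i)

/-- The finite `q`-shifted factorial `(x;q)_n = ∏_{0 ≤ i < n} (1 - x q^i)`. -/
def qPoch (x q : ℂ) (n : ℕ) : ℂ := ∏ i ∈ Finset.range n, (1 - x * q ^ i)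

/-- The partial theta function `θ(q,x) = ∑_{n ≥ 0} (-1)^n q^{n(n-1)/2} x^n`. -/
def partialTheta (q x : ℂ) : ℂ := ∑' n : ℕ, (-1) ^ n * q ^ (n.choose 2) * x ^ n

/-- `P_m(a,b) = (q,a,b;q)_∞ ∑_{n ≥ 0} (ab/q^m;q)_{2n} / (q,a,b,ab/q^m;q)_n * q^n`. -/
def seriesP (m : ℕ) (q a b : ℂ) : ℂ :=
  qPochInf q q * qPochInf a q * qPochInf b q *
    ∑' n : ℕ, qPoch (a * b / q ^ m) q (2 * n) /
      (qPoch q q n * qPoch a q n * qPoch b q n * qPoch (a * b / q ^ m) q n) * q ^ n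

/-- Every term of the series defining `P_m(a,b)` has a nonzero denominator (the factor `(q;q)_n`
never vanishes for `|q| < 1`). -/
def SeriesPDefined (m : ℕ) (q a b : ℂ) : Prop :=
  ∀ i : ℕ, a * q ^ i ≠ 1 ∧ b * q ^ i ≠ 1 ∧ a * b / q ^ m * q ^ i ≠ 1

/-- The value at `(q, a, b)` of a polynomial in three variables with rational coefficients. -/
def evalQAB (F : MvPolynomial (Fin 3) ℚ) (q a b : ℂ) : ℂ := MvPolynomial.aeval ![q, a, b] F

end

open Filter Topology

section PartialTheta

/-! Clearing denominators turns `P_m(a,b)` into an entire series `S(a,b,c)` at `c = ab/q^m`.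
Termwise, `(b-a) S(a,b,c) = b S(a/q,b,c) - a S(a,b/q,c)`. With `c` fixed, both series on the right
have index `m-1`, so induction on `m` applies. For `m = 1` the series is `θ(a) θ(b)`
(`entireSeries_eq_partialTheta_mul`): a telescoping sum gives `(1 + a T_a)(1 + b T_b) S = 1`, where
`T_x` replaces `x` by `xq`, and each factor is inverted by iteration on bounded functions. For `m =
2` the relation yields two products of thetas, which cancel by `θ(x/q) = 1 - (x/q) θ(x)`; the result
is linear in `θ(a)`, `θ(b)`. Each further step adds one shift in each variable and divides by `b -
a` at shifted points, whence the conditions `a ≠ b q^n`. -/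

lemma norm_mul_pow_le {q x : ℂ} (hq : ‖q‖ < 1) (n : ℕ) : ‖x * q ^ n‖ ≤ ‖x‖ := by
  rw [norm_mul, norm_pow]
  exact mul_le_of_le_one_right (norm_nonneg _) (pow_le_one₀ (norm_nonneg _) hq.le)

/-! ### The `q`-shifted factorials -/

lemma summable_norm_mul_pow {q : ℂ} (hq : ‖q‖ < 1) (x : ℂ) :
    Summable fun i : ℕ => ‖-(x * q ^ i)‖ := by
  simpa [norm_mul, norm_pow] using
    (summable_geometric_of_lt_one (norm_nonneg q) hq).mul_left ‖x‖

lemma tsum_norm_mul_pow {q : ℂ} (hq : ‖q‖ < 1) (x : ℂ) :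
    ∑' i : ℕ, ‖-(x * q ^ i)‖ = ‖x‖ * (1 - ‖q‖)⁻¹ := by
  simp only [norm_neg, norm_mul, norm_pow]
  rw [tsum_mul_left, tsum_geometric_of_lt_one (norm_nonneg q) hq]

lemma multipliable_one_sub_mul_pow {q : ℂ} (hq : ‖q‖ < 1) (x : ℂ) :
    Multipliable fun i : ℕ => 1 - x * q ^ i := by
  simpa [sub_eq_add_neg] using multipliable_one_add_of_summable (summable_norm_mul_pow hq x)

lemma norm_qPoch_sub_one_le {q : ℂ} (hq : ‖q‖ < 1) (x : ℂ) (n : ℕ) :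
    ‖qPoch x q n - 1‖ ≤ Real.exp (‖x‖ * (1 - ‖q‖)⁻¹) - 1 := by
  have h := Finset.norm_prod_one_add_sub_one_le (Finset.range n) fun i : ℕ => -(x * q ^ i)
  have h2 := (summable_norm_mul_pow hq x).sum_le_tsum (Finset.range n) fun _ _ => norm_nonneg _
  rw [tsum_norm_mul_pow hq] at h2
  refine le_trans ?_ (h.trans (sub_le_sub_right (Real.exp_le_exp.2 h2) 1))
  simp [qPoch, sub_eq_add_neg]

lemma norm_qPochInf_sub_one_le {q : ℂ} (hq : ‖q‖ < 1) (x : ℂ) :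
    ‖qPochInf x q - 1‖ ≤ Real.exp (‖x‖ * (1 - ‖q‖)⁻¹) - 1 :=
  le_of_tendsto' (((multipliable_one_sub_mul_pow hq x).hasProd.tendsto_prod_nat).sub_const 1).norm
    (norm_qPoch_sub_one_le hq x)

lemma norm_le_of_norm_sub_one_le {z : ℂ} {t : ℝ} (h : ‖z - 1‖ ≤ t - 1) : ‖z‖ ≤ t := by
  have := norm_add_le (z - 1) 1
  simp only [sub_add_cancel, norm_one] at this
  linarith

lemma exp_norm_mul_le {q x y : ℂ} (hq : ‖q‖ < 1) (h : ‖y‖ ≤ ‖x‖) :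
    Real.exp (‖y‖ * (1 - ‖q‖)⁻¹) ≤ Real.exp (‖x‖ * (1 - ‖q‖)⁻¹) :=
  Real.exp_le_exp.2 (mul_le_mul_of_nonneg_right h (inv_nonneg.2 (by linarith)))

lemma norm_qPochInf_le {q x y : ℂ} (hq : ‖q‖ < 1) (h : ‖y‖ ≤ ‖x‖) :
    ‖qPochInf y q‖ ≤ Real.exp (‖x‖ * (1 - ‖q‖)⁻¹) :=
  (norm_le_of_norm_sub_one_le (norm_qPochInf_sub_one_le hq y)).trans (exp_norm_mul_le hq h)

lemma norm_qPoch_le {q x y : ℂ} (hq : ‖q‖ < 1) (h : ‖y‖ ≤ ‖x‖) (n : ℕ) :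
    ‖qPoch y q n‖ ≤ Real.exp (‖x‖ * (1 - ‖q‖)⁻¹) :=
  (norm_le_of_norm_sub_one_le (norm_qPoch_sub_one_le hq y n)).trans (exp_norm_mul_le hq h)

lemma tendsto_mul_pow {q : ℂ} (hq : ‖q‖ < 1) (x : ℂ) :
    Tendsto (fun n : ℕ => x * q ^ n) atTop (𝓝 0) := by
  simpa using (tendsto_pow_atTop_nhds_zero_of_norm_lt_one hq).const_mul x

lemma tendsto_exp_norm_sub_one {q : ℂ} (hq : ‖q‖ < 1) (x : ℂ) :
    Tendsto (fun n : ℕ => Real.exp (‖x * q ^ n‖ * (1 - ‖q‖)⁻¹) - 1) atTop (𝓝 0) := by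
  have h := (tendsto_mul_pow hq x).norm.mul_const (1 - ‖q‖)⁻¹
  simpa using ((Real.continuous_exp.tendsto _).comp h).sub_const 1

lemma tendsto_qPochInf {q : ℂ} (hq : ‖q‖ < 1) (x : ℂ) :
    Tendsto (fun n : ℕ => qPochInf (x * q ^ n) q) atTop (𝓝 1) :=
  tendsto_iff_norm_sub_tendsto_zero.2 <|
    squeeze_zero (fun _ => norm_nonneg _) (fun _ => norm_qPochInf_sub_one_le hq _)
      (tendsto_exp_norm_sub_one hq x)

lemma tendsto_qPoch {q : ℂ} (hq : ‖q‖ < 1) (x : ℂ) :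
    Tendsto (fun n : ℕ => qPoch (x * q ^ n) q n) atTop (𝓝 1) :=
  tendsto_iff_norm_sub_tendsto_zero.2 <|
    squeeze_zero (fun _ => norm_nonneg _) (fun n => norm_qPoch_sub_one_le hq _ n)
      (tendsto_exp_norm_sub_one hq x)

lemma qPochInf_eq_mul {q : ℂ} (hq : ‖q‖ < 1) (x : ℂ) :
    qPochInf x q = (1 - x) * qPochInf (x * q) q := by
  have h (i : ℕ) : 1 - x * q ^ (i + 1) = 1 - x * q * q ^ i := by ring
  unfold qPochInf
  rw [tprod_eq_zero_mul' (by simpa only [h] using multipliable_one_sub_mul_pow hq (x * q))]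
  simp only [h, pow_zero, mul_one]

lemma qPoch_zero (x q : ℂ) : qPoch x q 0 = 1 := by simp [qPoch]

lemma qPoch_succ (x q : ℂ) (n : ℕ) : qPoch x q (n + 1) = qPoch x q n * (1 - x * q ^ n) := by
  simp [qPoch, Finset.prod_range_succ]

lemma qPoch_succ' (x q : ℂ) (n : ℕ) : qPoch x q (n + 1) = (1 - x) * qPoch (x * q) q n := by
  have h (i : ℕ) : 1 - x * q ^ (i + 1) = 1 - x * q * q ^ i := by ring
  simp [qPoch, Finset.prod_range_succ', h, mul_comm]

lemma qPoch_add (x q : ℂ) (m n : ℕ) :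
    qPoch x q (m + n) = qPoch x q m * qPoch (x * q ^ m) q n := by
  have h (i : ℕ) : 1 - x * q ^ (m + i) = 1 - x * q ^ m * q ^ i := by ring
  simp [qPoch, Finset.prod_range_add, h]

lemma qPochInf_eq_qPoch_mul {q : ℂ} (hq : ‖q‖ < 1) (x : ℂ) (n : ℕ) :
    qPochInf x q = qPoch x q n * qPochInf (x * q ^ n) q := by
  induction n with
  | zero => simp [qPoch_zero]
  | succ n ih => rw [ih, qPoch_succ, qPochInf_eq_mul hq (x * q ^ n), pow_succ]; ring_nf

lemma qPoch_ne_zero {x q : ℂ} (h : ∀ i : ℕ, x * q ^ i ≠ 1) (n : ℕ) : qPoch x q n ≠ 0 :=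
  Finset.prod_ne_zero_iff.2 fun i _ => sub_ne_zero.2 (h i).symm

/-! ### The partial theta function -/

lemma summable_partialTheta {q : ℂ} (hq : ‖q‖ < 1) (x : ℂ) :
    Summable fun n : ℕ => (-1) ^ n * q ^ n.choose 2 * x ^ n := by
  set u : ℕ → ℂ := fun n => (-1) ^ n * q ^ n.choose 2 * x ^ n with hu
  have hev : ∀ᶠ n : ℕ in atTop, ‖x * q ^ n‖ < 1 / 2 := by
    have := (tendsto_mul_pow hq x).norm
    rw [norm_zero] at this
    exact this.eventually_lt_const (by norm_num)
  refine summable_of_ratio_norm_eventually_le (r := 1 / 2) (by norm_num) ?_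
  filter_upwards [hev] with n hn
  have : u (n + 1) = -(x * q ^ n) * u n := by
    simp only [hu]
    rw [show (n + 1).choose 2 = n + n.choose 2 by simp [Nat.choose_succ_succ' n 1]]
    ring
  rw [this, norm_mul, norm_neg]
  exact mul_le_mul_of_nonneg_right hn.le (norm_nonneg _)

/-- Iterating `f n = K - x q^n f (n+1)` produces the partial sums of `θ`. The remainder is a term of
the theta series times `f N`, and vanishes in the limit because `f` is bounded. -/
lemma eq_mul_partialTheta {q x K : ℂ} (hq : ‖q‖ < 1) {f : ℕ → ℂ} {C : ℝ} (hC : ∀ n, ‖f n‖ ≤ C)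
    (hf : ∀ n, f n + x * q ^ n * f (n + 1) = K) : f 0 = K * partialTheta q x := by
  have hs (N : ℕ) : K * ∑ n ∈ Finset.range N, (-1) ^ n * q ^ n.choose 2 * x ^ n =
      f 0 - (-1) ^ N * q ^ N.choose 2 * x ^ N * f N := by
    induction N with
    | zero => simp
    | succ N ih =>
      rw [Finset.sum_range_succ, mul_add, ih, ← hf N,
        show (N + 1).choose 2 = N + N.choose 2 by simp [Nat.choose_succ_succ' N 1]]
      ring
  set u : ℕ → ℂ := fun n => (-1) ^ n * q ^ n.choose 2 * x ^ n with hu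
  have hsum : Summable u := summable_partialTheta hq x
  have h1 : Tendsto (fun N => K * ∑ n ∈ Finset.range N, u n) atTop (𝓝 (K * ∑' n, u n)) :=
    hsum.hasSum.tendsto_sum_nat.const_mul K
  have h2 : Tendsto (fun N => u N * f N) atTop (𝓝 0) := by
    refine squeeze_zero_norm (a := fun N => ‖u N‖ * C) (fun N => ?_) ?_
    · rw [norm_mul]
      exact mul_le_mul_of_nonneg_left (hC N) (norm_nonneg _)
    · simpa using hsum.tendsto_atTop_zero.norm.mul_const C
  have h3 : Tendsto (fun N => K * ∑ n ∈ Finset.range N, u n) atTop (𝓝 (f 0)) := by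
    have h4 : Tendsto (fun N => f 0 - u N * f N) atTop (𝓝 (f 0)) := by
      simpa using tendsto_const_nhds.sub h2
    exact h4.congr fun N => (hs N).symm
  exact tendsto_nhds_unique h3 h1

lemma partialTheta_eq {q : ℂ} (hq : ‖q‖ < 1) (x : ℂ) :
    partialTheta q x = 1 - x * partialTheta q (x * q) := by
  unfold partialTheta
  rw [(summable_partialTheta hq x).tsum_eq_zero_add, ← tsum_mul_left, sub_eq_add_neg, ← tsum_neg]
  congr 1
  · simp
  · refine tsum_congr fun n => ?_
    rw [show (n + 1).choose 2 = n + n.choose 2 by simp [Nat.choose_succ_succ' n 1]]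
    ring

/-! ### The entire form of the series -/

/-- The terms of `entireSeries`. -/
noncomputable def entireTerm (q a b c : ℂ) (n : ℕ) : ℂ :=
  qPochInf (q * q ^ n) q * qPochInf (a * q ^ n) q * qPochInf (b * q ^ n) q *
    qPoch (c * q ^ n) q n * q ^ n

/-- The series `∑ (q^{n+1}, a q^n, b q^n; q)_∞ (c q^n; q)_n q^n`, which equals `P_m(a,b)` for
`c = ab/q^m` but makes sense for all `a`, `b`, `c`. -/
noncomputable def entireSeries (q a b c : ℂ) : ℂ := ∑' n, entireTerm q a b c n

/-- A bound for the factors of `entireTerm`. -/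
noncomputable def entireBound (q a b c : ℂ) : ℝ :=
  Real.exp (‖q‖ * (1 - ‖q‖)⁻¹) * Real.exp (‖a‖ * (1 - ‖q‖)⁻¹) *
    Real.exp (‖b‖ * (1 - ‖q‖)⁻¹) * Real.exp (‖c‖ * (1 - ‖q‖)⁻¹)

lemma norm_entireTerm_le {q a b c a' b' c' : ℂ} (hq : ‖q‖ < 1) (ha : ‖a'‖ ≤ ‖a‖)
    (hb : ‖b'‖ ≤ ‖b‖) (hc : ‖c'‖ ≤ ‖c‖) (n : ℕ) :
    ‖entireTerm q a' b' c' n‖ ≤ entireBound q a b c * ‖q‖ ^ n := by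
  have h1 := norm_qPochInf_le hq (norm_mul_pow_le (x := q) hq n)
  have h2 := norm_qPochInf_le hq ((norm_mul_pow_le (x := a') hq n).trans ha)
  have h3 := norm_qPochInf_le hq ((norm_mul_pow_le (x := b') hq n).trans hb)
  have h4 := norm_qPoch_le hq ((norm_mul_pow_le (x := c') hq n).trans hc) n
  unfold entireTerm entireBound
  simp only [norm_mul, norm_pow] at *
  gcongr

lemma summable_entireTerm {q : ℂ} (hq : ‖q‖ < 1) (a b c : ℂ) :
    Summable (entireTerm q a b c) :=
  .of_norm_bounded ((summable_geometric_of_lt_one (norm_nonneg q) hq).mul_left _)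
    (norm_entireTerm_le hq le_rfl le_rfl le_rfl)

lemma norm_entireSeries_le {q a b c a' b' c' : ℂ} (hq : ‖q‖ < 1) (ha : ‖a'‖ ≤ ‖a‖)
    (hb : ‖b'‖ ≤ ‖b‖) (hc : ‖c'‖ ≤ ‖c‖) :
    ‖entireSeries q a' b' c'‖ ≤ entireBound q a b c * (1 - ‖q‖)⁻¹ := by
  refine tsum_of_norm_bounded ?_ (norm_entireTerm_le hq ha hb hc)
  exact (hasSum_geometric_of_lt_one (norm_nonneg q) hq).mul_left _

lemma seriesP_eq_entireSeries {m : ℕ} {q a b : ℂ} (hq : ‖q‖ < 1) (h : SeriesPDefined m q a b) :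
    seriesP m q a b = entireSeries q a b (a * b / q ^ m) := by
  unfold seriesP entireSeries
  rw [← tsum_mul_left]
  refine tsum_congr fun n => ?_
  have hqn : qPoch q q n ≠ 0 := qPoch_ne_zero (fun i h1 => by
    have h2 : ‖q ^ (i + 1)‖ < 1 := by
      rw [norm_pow]; exact pow_lt_one₀ (norm_nonneg _) hq i.succ_ne_zero
    rw [pow_succ', h1, norm_one] at h2
    exact lt_irrefl _ h2) n
  have han := qPoch_ne_zero (fun i => (h i).1) n
  have hbn := qPoch_ne_zero (fun i => (h i).2.1) n
  have hcn := qPoch_ne_zero (fun i => (h i).2.2) n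
  rw [entireTerm, two_mul, qPoch_add, qPochInf_eq_qPoch_mul hq q n, qPochInf_eq_qPoch_mul hq a n,
    qPochInf_eq_qPoch_mul hq b n]
  generalize a * b / q ^ m = c at *
  field_simp

/-- Replacing `x` by `x/q` inserts the factor `1 - x q^(n-1)` in the `n`-th term, and `b(1 - a
q^(n-1)) - a(1 - b q^(n-1)) = b - a`. -/
lemma sub_mul_entireSeries {q : ℂ} (hq0 : q ≠ 0) (hq : ‖q‖ < 1) (a b c : ℂ) :
    (b - a) * entireSeries q a b c =
      b * entireSeries q (a / q) b c - a * entireSeries q a (b / q) c := by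
  unfold entireSeries
  rw [← tsum_mul_left, ← tsum_mul_left, ← tsum_mul_left,
    ← ((summable_entireTerm hq _ _ _).mul_left b).tsum_sub
      ((summable_entireTerm hq _ _ _).mul_left a)]
  refine tsum_congr fun n => ?_
  have h (x : ℂ) : qPochInf (x / q * q ^ n) q = (1 - x / q * q ^ n) * qPochInf (x * q ^ n) q := by
    rw [qPochInf_eq_mul hq, show x / q * q ^ n * q = x * q ^ n by field_simp]
  simp only [entireTerm, h]
  field_simp
  ring

/-! ### The product of two partial theta functions -/

/-- The combination telescopes; the closed form tends to `1` as `N → ∞`. -/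
lemma sum_entireTerm {q : ℂ} (hq0 : q ≠ 0) (hq : ‖q‖ < 1) (a b : ℂ) (N : ℕ) :
    ∑ n ∈ Finset.range (N + 1), (entireTerm q a b (a * b / q) n +
      a * entireTerm q (a * q) b (a * b) n + b * entireTerm q a (b * q) (a * b) n +
      a * b * entireTerm q (a * q) (b * q) (a * b * q) n) =
    qPochInf (q * q ^ N) q * qPochInf (a * q * q ^ N) q * qPochInf (b * q * q ^ N) q *
      qPoch (a * b * q * q ^ N) q N := by
  induction N with
  | zero =>
    simp only [zero_add, Finset.sum_range_one, entireTerm, pow_zero, mul_one, qPoch_zero]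
    rw [qPochInf_eq_mul hq a, qPochInf_eq_mul hq b]
    ring
  | succ N ih =>
    rw [Finset.sum_range_succ, ih]
    obtain ⟨x, hx⟩ : ∃ x, x = q ^ N := ⟨_, rfl⟩
    have hR : qPoch (a * b / q * q ^ (N + 1)) q (N + 1) =
        (1 - a * b * x) * qPoch (a * b * q * x) q N := by
      rw [qPoch_succ', show a * b / q * q ^ (N + 1) = a * b * x by rw [hx]; field_simp; ring]
      ring_nf
    have hM : qPoch (a * b * q ^ (N + 1)) q (N + 1) =
        qPoch (a * b * q * x) q N * (1 - a * b * q * x * x) := by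
      rw [qPoch_succ, hx]; ring_nf
    -- `Z = (abq²x;q)_{N-1}` is the common part of the finite products. It does not exist for `N =
    -- 0`, which is checked directly.
    have hS : ∃ Z, (N = 0 ∨ qPoch (a * b * q * x) q N = (1 - a * b * q * x) * Z) ∧
        (N ≠ 0 → qPoch (a * b * q * q ^ (N + 1)) q (N + 1) =
          Z * (1 - a * b * q * x * x) * (1 - a * b * q ^ 2 * x * x)) := by
      rcases N with _ | k
      · exact ⟨0, by simp⟩
      · refine ⟨qPoch (a * b * q * x * q) q k, Or.inr (qPoch_succ' _ _ _), fun _ => ?_⟩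
        rw [qPoch_succ, qPoch_succ, hx]
        ring_nf
    have h1 : qPochInf (q * x) q = (1 - q * x) * qPochInf (q * q ^ (N + 1)) q := by
      rw [qPochInf_eq_mul hq, hx]; ring_nf
    have h2 (y : ℂ) : qPochInf (y * q * x) q =
        (1 - y * q * x) * qPochInf (y * q * q ^ (N + 1)) q := by
      rw [qPochInf_eq_mul hq, hx]; ring_nf
    have h3 (y : ℂ) : qPochInf (y * q ^ (N + 1)) q =
        (1 - y * q * x) * qPochInf (y * q * q ^ (N + 1)) q := by
      rw [← h2, hx]; ring_nf
    simp only [entireTerm]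
    rw [← hx, hR, hM, h1, h2, h2, h3 a, h3 b]
    obtain ⟨Z, hZ, hZ'⟩ := hS
    generalize qPochInf (q * q ^ (N + 1)) q = p1
    generalize qPochInf (a * q * q ^ (N + 1)) q = p2
    generalize qPochInf (b * q * q ^ (N + 1)) q = p3
    rcases eq_or_ne N 0 with rfl | hN
    · simp only [pow_zero] at hx
      subst hx
      simp only [qPoch, zero_add, Finset.range_one, Finset.prod_singleton, Finset.range_zero,
        Finset.prod_empty, pow_zero, pow_one]
      ring
    · rw [hZ' hN, hZ.resolve_left hN, pow_succ, ← hx]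
      ring

lemma entireSeries_add_shifts {q : ℂ} (hq0 : q ≠ 0) (hq : ‖q‖ < 1) (a b : ℂ) :
    entireSeries q a b (a * b / q) + a * entireSeries q (a * q) b (a * b) +
      b * entireSeries q a (b * q) (a * b) +
      a * b * entireSeries q (a * q) (b * q) (a * b * q) = 1 := by
  have hsum := ((((summable_entireTerm hq a b (a * b / q)).hasSum.add
    ((summable_entireTerm hq (a * q) b (a * b)).hasSum.mul_left a)).add
    ((summable_entireTerm hq a (b * q) (a * b)).hasSum.mul_left b)).add
    ((summable_entireTerm hq (a * q) (b * q) (a * b * q)).hasSum.mul_left (a * b)))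
  have h1 := (tendsto_add_atTop_iff_nat 1).2 hsum.tendsto_sum_nat
  simp only [sum_entireTerm hq0 hq] at h1
  have h2 := (((tendsto_qPochInf hq q).mul (tendsto_qPochInf hq (a * q))).mul
    (tendsto_qPochInf hq (b * q))).mul (tendsto_qPoch hq (a * b * q))
  simp only [mul_one] at h2
  exact tendsto_nhds_unique h1 h2

lemma entireSeries_eq_partialTheta_mul {q : ℂ} (hq0 : q ≠ 0) (hq : ‖q‖ < 1) (a b : ℂ) :
    entireSeries q a b (a * b / q) = partialTheta q a * partialTheta q b := by
  have hle (x y : ℂ) (i j : ℕ) : ‖x * q ^ i * (y * q ^ j) / q‖ ≤ ‖x * y / q‖ := by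
    rw [show x * q ^ i * (y * q ^ j) / q = x * y / q * q ^ (i + j) by ring]
    exact norm_mul_pow_le hq _
  have hbd (x y : ℂ) (i j : ℕ) :
      ‖entireSeries q (x * q ^ i) (y * q ^ j) (x * q ^ i * (y * q ^ j) / q)‖ ≤
        entireBound q x y (x * y / q) * (1 - ‖q‖)⁻¹ :=
    norm_entireSeries_le hq (norm_mul_pow_le hq i) (norm_mul_pow_le hq j) (hle x y i j)
  -- Inverts `1 + b T_b`, with `K = 1`; the second use of `eq_mul_partialTheta` inverts `1 + a T_a`,
  -- with `K = θ(b)`.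
  have key (x : ℂ) : entireSeries q x b (x * b / q) + x * entireSeries q (x * q) b (x * b) =
      partialTheta q b := by
    have h := eq_mul_partialTheta (x := b) (K := 1) hq
      (f := fun n => entireSeries q x (b * q ^ n) (x * (b * q ^ n) / q) +
        x * entireSeries q (x * q) (b * q ^ n) (x * (b * q ^ n)))
      (C := entireBound q x b (x * b / q) * (1 - ‖q‖)⁻¹ +
        ‖x‖ * (entireBound q x b (x * b / q) * (1 - ‖q‖)⁻¹)) (fun n => ?_) (fun n => ?_)
    · simpa using h
    · refine (norm_add_le _ _).trans (add_le_add ?_ ?_)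
      · simpa using hbd x b 0 n
      · rw [norm_mul]
        refine mul_le_mul_of_nonneg_left ?_ (norm_nonneg _)
        have := hbd x b 1 n
        rwa [pow_one, show x * q * (b * q ^ n) / q = x * (b * q ^ n) by field_simp] at this
    · rw [← entireSeries_add_shifts hq0 hq x (b * q ^ n), pow_succ, ← mul_assoc b,
        show x * (b * q ^ n * q) / q = x * (b * q ^ n) by field_simp,
        show x * (b * q ^ n * q) = x * (b * q ^ n) * q by ring]
      ring
  have h := eq_mul_partialTheta (x := a) (K := partialTheta q b) hq
    (f := fun n => entireSeries q (a * q ^ n) b (a * q ^ n * b / q))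
    (C := entireBound q a b (a * b / q) * (1 - ‖q‖)⁻¹) (fun n => ?_) (fun n => ?_)
  · rw [mul_comm (partialTheta q a)]; simpa using h
  · simpa using hbd a b n 0
  · rw [← key (a * q ^ n), pow_succ, ← mul_assoc a,
      show a * q ^ n * q * b / q = a * q ^ n * b by field_simp]

lemma sub_mul_entireSeries_two {q : ℂ} (hq0 : q ≠ 0) (hq : ‖q‖ < 1) (a b : ℂ) :
    (b - a) * entireSeries q a b (a * b / q ^ 2) =
      b * partialTheta q b - a * partialTheta q a := by
  have h1 := entireSeries_eq_partialTheta_mul hq0 hq (a / q) b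
  have h2 := entireSeries_eq_partialTheta_mul hq0 hq a (b / q)
  rw [show a / q * b / q = a * b / q ^ 2 by field_simp] at h1
  rw [show a * (b / q) / q = a * b / q ^ 2 by field_simp] at h2
  rw [sub_mul_entireSeries hq0 hq, h1, h2, partialTheta_eq hq (a / q), partialTheta_eq hq (b / q),
    div_mul_cancel₀ _ hq0, div_mul_cancel₀ _ hq0]
  ring

end PartialTheta

/-! ### Rational functions without poles on a set -/

section RationalOn

variable {σ τ : Type*}

/-- `f` agrees on `S` with a quotient of polynomials over `ℚ` whose denominator has no zero
in `S`. -/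
def RationalOn (S : Set (σ → ℂ)) (f : (σ → ℂ) → ℂ) : Prop :=
  ∃ N D : MvPolynomial σ ℚ, ∀ v ∈ S, MvPolynomial.aeval v D ≠ 0 ∧
    f v = MvPolynomial.aeval v N / MvPolynomial.aeval v D

namespace RationalOn

variable {S : Set (σ → ℂ)} {f g : (σ → ℂ) → ℂ}

lemma coord (i : σ) : RationalOn S fun v => v i :=
  ⟨MvPolynomial.X i, 1, by simp⟩

lemma zero : RationalOn S fun _ => 0 := ⟨0, 1, by simp⟩

lemma const (r : ℚ) : RationalOn S fun _ => algebraMap ℚ ℂ r :=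
  ⟨MvPolynomial.C r, 1, by simp⟩

lemma add (hf : RationalOn S f) (hg : RationalOn S g) : RationalOn S fun v => f v + g v := by
  obtain ⟨N, D, h⟩ := hf
  obtain ⟨N', D', h'⟩ := hg
  refine ⟨N * D' + D * N', D * D', fun v hv => ?_⟩
  obtain ⟨h1, h2⟩ := h v hv
  obtain ⟨h3, h4⟩ := h' v hv
  simp only [map_add, map_mul]
  exact ⟨mul_ne_zero h1 h3, by rw [h2, h4, div_add_div _ _ h1 h3]⟩

lemma mul (hf : RationalOn S f) (hg : RationalOn S g) : RationalOn S fun v => f v * g v := by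
  obtain ⟨N, D, h⟩ := hf
  obtain ⟨N', D', h'⟩ := hg
  refine ⟨N * N', D * D', fun v hv => ?_⟩
  obtain ⟨h1, h2⟩ := h v hv
  obtain ⟨h3, h4⟩ := h' v hv
  simp only [map_mul]
  exact ⟨mul_ne_zero h1 h3, by rw [h2, h4, div_mul_div_comm]⟩

lemma sub (hf : RationalOn S f) (hg : RationalOn S g) : RationalOn S fun v => f v - g v := by
  simpa [sub_eq_add_neg] using hf.add ((const (-1)).mul hg)

lemma div (hf : RationalOn S f) (hg : RationalOn S g) (h0 : ∀ v ∈ S, g v ≠ 0) :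
    RationalOn S fun v => f v / g v := by
  obtain ⟨N, D, h⟩ := hf
  obtain ⟨N', D', h'⟩ := hg
  refine ⟨N * D', D * N', fun v hv => ?_⟩
  obtain ⟨h1, h2⟩ := h v hv
  obtain ⟨h3, h4⟩ := h' v hv
  have h5 := h0 v hv
  rw [h4] at h5
  have h6 := (div_ne_zero_iff.1 h5).1
  simp only [map_mul]
  exact ⟨mul_ne_zero h1 h6, by rw [h2, h4, div_div_div_eq]⟩

/-- Needed for the substitutions `a ↦ a/q` and `b ↦ b/q` in the coefficients. -/
lemma comp {T : Set (τ → ℂ)} {φ : (τ → ℂ) → σ → ℂ} (hf : RationalOn S f)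
    (hφ : ∀ i, RationalOn T fun v => φ v i) (hST : ∀ v ∈ T, φ v ∈ S) :
    RationalOn T fun v => f (φ v) := by
  have key (F : MvPolynomial σ ℚ) : RationalOn T fun v => MvPolynomial.aeval (φ v) F := by
    induction F using MvPolynomial.induction_on with
    | C r => simpa using const r
    | add p q hp hq => simpa using hp.add hq
    | mul_X p i hp => simpa using hp.mul (hφ i)
  obtain ⟨N, D, h⟩ := hf
  obtain ⟨N', D', h'⟩ := (key N).div (key D) fun v hv => (h _ (hST v hv)).1
  exact ⟨N', D', fun v hv => ⟨(h' v hv).1, (h _ (hST v hv)).2.trans (h' v hv).2⟩⟩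

lemma exists_common_denominator {f : ℕ → (σ → ℂ) → ℂ} (hf : ∀ k, RationalOn S (f k)) (n : ℕ) :
    ∃ (D : MvPolynomial σ ℚ) (N : ℕ → MvPolynomial σ ℚ), ∀ v ∈ S, MvPolynomial.aeval v D ≠ 0 ∧
      ∀ k < n, f k v = MvPolynomial.aeval v (N k) / MvPolynomial.aeval v D := by
  choose N D h using hf
  refine ⟨∏ k ∈ Finset.range n, D k, fun k => N k * ∏ j ∈ (Finset.range n).erase k, D j,
    fun v hv => ⟨?_, fun k hk => ?_⟩⟩
  · rw [map_prod]
    exact Finset.prod_ne_zero_iff.2 fun k _ => (h k v hv).1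
  · rw [(h k v hv).2, ← Finset.mul_prod_erase _ _ (Finset.mem_range.2 hk), map_mul, map_mul,
      mul_div_mul_right]
    rw [map_prod]
    exact Finset.prod_ne_zero_iff.2 fun k _ => (h k v hv).1

end RationalOn

end RationalOn

/-! ### Induction on `m = r + 2` -/

/-- The points `(q, a, b)` with `0 < |q| < 1` and `a ≠ b q^n` whenever `|n| ≤ r`. -/
def qabRegion (r : ℕ) : Set (Fin 3 → ℂ) :=
  {v | v 0 ≠ 0 ∧ ‖v 0‖ < 1 ∧ ∀ n : ℤ, |n| ≤ r → v 1 ≠ v 2 * v 0 ^ n}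

lemma qabRegion_sub_ne_zero {r : ℕ} {v : Fin 3 → ℂ} (hv : v ∈ qabRegion r) : v 2 - v 1 ≠ 0 := by
  have := hv.2.2 0 (by simp)
  rw [zpow_zero, mul_one] at this
  exact sub_ne_zero.2 this.symm

/-- `a/q = b q^n` means `a = b q^(n+1)`, so a shift costs one unit of `r`. -/
lemma qabRegion_shift_left {r : ℕ} {v : Fin 3 → ℂ} (hv : v ∈ qabRegion (r + 1)) :
    ![v 0, v 1 / v 0, v 2] ∈ qabRegion r := by
  obtain ⟨h0, h1, h⟩ := hv
  refine ⟨h0, h1, fun n hn he => h (n + 1) ?_ ?_⟩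
  · have := abs_add_le n 1
    push_cast
    rw [abs_one] at this
    linarith
  · simp only [Matrix.cons_val] at he
    rw [zpow_add_one₀ h0, ← mul_assoc, ← he, div_mul_cancel₀ _ h0]

lemma qabRegion_shift_right {r : ℕ} {v : Fin 3 → ℂ} (hv : v ∈ qabRegion (r + 1)) :
    ![v 0, v 1, v 2 / v 0] ∈ qabRegion r := by
  obtain ⟨h0, h1, h⟩ := hv
  refine ⟨h0, h1, fun n hn he => h (n - 1) ?_ ?_⟩
  · have := abs_sub n 1
    push_cast
    rw [abs_one] at this
    linarith
  · simp only [Matrix.cons_val] at he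
    rw [zpow_sub_one₀ h0, he]
    ring

lemma RationalOn.shift_left {r : ℕ} {f : (Fin 3 → ℂ) → ℂ} (hf : RationalOn (qabRegion r) f) :
    RationalOn (qabRegion (r + 1)) fun v => f ![v 0, v 1 / v 0, v 2] := by
  refine hf.comp (fun i => ?_) fun v hv => qabRegion_shift_left hv
  fin_cases i
  · exact coord 0
  · exact (coord 1).div (coord 0) fun v hv => hv.1
  · exact coord 2

lemma RationalOn.shift_right {r : ℕ} {f : (Fin 3 → ℂ) → ℂ} (hf : RationalOn (qabRegion r) f) :
    RationalOn (qabRegion (r + 1)) fun v => f ![v 0, v 1, v 2 / v 0] := by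
  refine hf.comp (fun i => ?_) fun v hv => qabRegion_shift_right hv
  fin_cases i
  · exact coord 0
  · exact coord 1
  · exact (coord 2).div (coord 0) fun v hv => hv.1

/-- Shift a sequence of functions by one place, starting with `0`. -/
def shiftCoeff (f : ℕ → (Fin 3 → ℂ) → ℂ) : ℕ → (Fin 3 → ℂ) → ℂ
  | 0 => fun _ => 0
  | k + 1 => f k

lemma sum_shiftCoeff (f : ℕ → (Fin 3 → ℂ) → ℂ) (n : ℕ) (v : Fin 3 → ℂ) (u : ℕ → ℂ) :
    ∑ k ∈ Finset.range (n + 1), shiftCoeff f k v * u k =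
      ∑ k ∈ Finset.range n, f k v * u (k + 1) := by
  simp [Finset.sum_range_succ', shiftCoeff]

lemma exists_rationalOn_entireSeries (r : ℕ) :
    ∃ α β : ℕ → (Fin 3 → ℂ) → ℂ,
      (∀ k, RationalOn (qabRegion r) (α k)) ∧ (∀ k, RationalOn (qabRegion r) (β k)) ∧
      ∀ v ∈ qabRegion r, entireSeries (v 0) (v 1) (v 2) (v 1 * v 2 / v 0 ^ (r + 2)) =
        ∑ k ∈ Finset.range (r + 1), α k v * partialTheta (v 0) (v 1 / v 0 ^ k) +
        ∑ k ∈ Finset.range (r + 1), β k v * partialTheta (v 0) (v 2 / v 0 ^ k) := by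
  induction r with
  | zero =>
    refine ⟨fun _ v => (0 - v 1) / (v 2 - v 1), fun _ v => v 2 / (v 2 - v 1),
      fun _ => (RationalOn.zero.sub (.coord 1)).div ((RationalOn.coord 2).sub (.coord 1)) ?_,
      fun _ => (RationalOn.coord 2).div ((RationalOn.coord 2).sub (.coord 1)) ?_, ?_⟩
    · exact fun v hv => qabRegion_sub_ne_zero hv
    · exact fun v hv => qabRegion_sub_ne_zero hv
    · intro v hv
      have h := sub_mul_entireSeries_two hv.1 hv.2.1 (v 1) (v 2)
      have h0 := qabRegion_sub_ne_zero hv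
      simp only [zero_add, Finset.sum_range_one, pow_zero, div_one]
      rw [← mul_right_inj' h0, h]
      field_simp
      ring
  | succ r ih =>
    obtain ⟨α, β, hα, hβ, h⟩ := ih
    have hd : RationalOn (qabRegion (r + 1)) fun v => v 2 - v 1 :=
      (RationalOn.coord 2).sub (.coord 1)
    have hd0 : ∀ v ∈ qabRegion (r + 1), v 2 - v 1 ≠ 0 := fun v hv => qabRegion_sub_ne_zero hv
    have hs {f : ℕ → (Fin 3 → ℂ) → ℂ} (hf : ∀ k, RationalOn (qabRegion (r + 1)) (f k)) (k : ℕ) :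
        RationalOn (qabRegion (r + 1)) (shiftCoeff f k) := by
      cases k with
      | zero => exact .zero
      | succ k => exact hf k
    -- The induction hypothesis says nothing useful about coefficients with `k > r`, so they are cut
    -- to `0` in the longer sum.
    have hi {f : (Fin 3 → ℂ) → ℂ} (hf : RationalOn (qabRegion (r + 1)) f) (k : ℕ) :
        RationalOn (qabRegion (r + 1)) fun v => if k < r + 1 then f v else 0 := by
      split_ifs
      · exact hf
      · exact .zero
    have hsum (f : ℕ → ℂ) (u : ℕ → ℂ) :
        ∑ k ∈ Finset.range (r + 1 + 1), (if k < r + 1 then f k else 0) * u k =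
          ∑ k ∈ Finset.range (r + 1), f k * u k := by
      rw [Finset.sum_range_succ, if_neg (lt_irrefl _), zero_mul, add_zero]
      exact Finset.sum_congr rfl fun k hk => by rw [if_pos (Finset.mem_range.1 hk)]
    -- The shift `a ↦ a/q` moves `θ(a/q^k)` to `θ(a/q^(k+1))` and fixes `θ(b/q^k)`; `b ↦ b/q` does
    -- the reverse. Moved families get `shiftCoeff`, fixed ones the cut-off.
    refine ⟨fun k v => (v 2 * shiftCoeff (fun k v => α k ![v 0, v 1 / v 0, v 2]) k v -
        v 1 * if k < r + 1 then α k ![v 0, v 1, v 2 / v 0] else 0) / (v 2 - v 1),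
      fun k v => (v 2 * (if k < r + 1 then β k ![v 0, v 1 / v 0, v 2] else 0) -
        v 1 * shiftCoeff (fun k v => β k ![v 0, v 1, v 2 / v 0]) k v) / (v 2 - v 1),
      fun k => ((RationalOn.mul (.coord 2) (hs (fun k => (hα k).shift_left) k)).sub
        (RationalOn.mul (.coord 1) (hi (hα k).shift_right k))).div hd hd0,
      fun k => ((RationalOn.mul (.coord 2) (hi (hβ k).shift_left k)).sub
        (RationalOn.mul (.coord 1) (hs (fun k => (hβ k).shift_right) k))).div hd hd0, ?_⟩
    intro v hv
    have hq0 := hv.1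
    have h1 := h _ (qabRegion_shift_left hv)
    have h2 := h _ (qabRegion_shift_right hv)
    simp only [Matrix.cons_val] at h1 h2
    have h3 := sub_mul_entireSeries hv.1 hv.2.1 (v 1) (v 2) (v 1 * v 2 / v 0 ^ (r + 1 + 2))
    rw [show v 1 / v 0 * v 2 / v 0 ^ (r + 2) = v 1 * v 2 / v 0 ^ (r + 1 + 2) by
      field_simp; ring] at h1
    rw [show v 1 * (v 2 / v 0) / v 0 ^ (r + 2) = v 1 * v 2 / v 0 ^ (r + 1 + 2) by
      field_simp; ring] at h2
    have hp (x : ℂ) (k : ℕ) : x / v 0 / v 0 ^ k = x / v 0 ^ (k + 1) := by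
      rw [div_div, pow_succ']
    simp only [hp] at h1 h2
    rw [← mul_right_inj' (hd0 v hv), h3, h1, h2]
    have e (x y z : ℂ) : (x - y) / (v 2 - v 1) * z = (v 2 - v 1)⁻¹ * (x * z - y * z) := by ring
    simp only [e, ← Finset.mul_sum, Finset.sum_sub_distrib, mul_assoc, hsum, sum_shiftCoeff]
    rw [← mul_add, mul_inv_cancel_left₀ (hd0 v hv)]
    ring

theorem mainTheorem2 (m : ℕ) (hm : 2 ≤ m) :
    ∃ (D : MvPolynomial (Fin 3) ℚ) (A B : ℕ → MvPolynomial (Fin 3) ℚ),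
      ∀ q a b : ℂ, q ≠ 0 → ‖q‖ < 1 →
        (∀ n : ℤ, |n| ≤ (m : ℤ) - 2 → a ≠ b * q ^ n) →
        evalQAB D q a b ≠ 0 ∧
        (SeriesPDefined m q a b →
          seriesP m q a b =
            ∑ k ∈ Finset.range (m - 1),
                evalQAB (A k) q a b / evalQAB D q a b * partialTheta q (a / q ^ k) +
            ∑ k ∈ Finset.range (m - 1),
                evalQAB (B k) q a b / evalQAB D q a b * partialTheta q (b / q ^ k)) := by
  obtain ⟨r, rfl⟩ := Nat.exists_eq_add_of_le' hm
  obtain ⟨α, β, hα, hβ, h⟩ := exists_rationalOn_entireSeries r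
  obtain ⟨D, A, hA⟩ := RationalOn.exists_common_denominator hα (r + 1)
  obtain ⟨E, B, hB⟩ := RationalOn.exists_common_denominator hβ (r + 1)
  refine ⟨D * E, fun k => A k * E, fun k => D * B k, fun q a b hq0 hq hab => ?_⟩
  have hv : ![q, a, b] ∈ qabRegion r := ⟨hq0, hq, fun n hn => hab n (by push_cast; linarith)⟩
  obtain ⟨hD, hA⟩ := hA _ hv
  obtain ⟨hE, hB⟩ := hB _ hv
  simp only [evalQAB, map_mul]
  refine ⟨mul_ne_zero hD hE, fun hdef => ?_⟩
  have h1 := h _ hv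
  simp only [Matrix.cons_val] at h1
  rw [seriesP_eq_entireSeries hq hdef, h1]
  congr 1
  · refine Finset.sum_congr rfl fun k hk => ?_
    rw [hA k (Finset.mem_range.1 hk), mul_div_mul_right _ _ hE]
  · refine Finset.sum_congr rfl fun k hk => ?_
    rw [hB k (Finset.mem_range.1 hk), mul_div_mul_left _ _ hD]
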